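/- A diffeological space is a set $X$ with a family of maps $U \to X$ (plots), $U$ open in some $\mathbb{R}^n$, that contains the constant maps, is closed under precomposition with smooth maps, and satisfies the sheaf condition for open covers; a map is smooth if it sends plots to plots. The $D$-topology on $X$ is the final topology with respect to the plots. A smooth manifold (finite-dimensional, Hausdorff, second countable, without boundary) carries the diffeology of all smooth maps in the usual sense, a product has as plots the maps whose components are plots, a subset has as plots the plots of the ambient space that take values in it, and the set $C^\infty(X,Y)$ of smooth maps has as plots the maps $p\colon U \to C^\infty(X,Y)$ for which $U \times X \to Y$, $(u,x) \mapsto p(u)(x)$, is smooth. Let $\mathbb{A}^n = \{(x_0,\dots,x_n) \in \mathbb{R}^{n+1} : \sum_i x_i = 1\}$ with the sub-diffeology. A diffeological space $Y$ is called fibrant if its smooth singular simplicial set $S^D(Y)$, with $S^D_n(Y) = C^\infty(\mathbb{A}^n, Y)$ and the simplicial structure induced by the standard affine maps between the $\mathbb{A}^n$, is a Kan complex. Let $X$ be a diffeological space that is compact in the $D$-topology, and let $N$ be a smooth manifold. Then $C^\infty(X,N)$ is fibrant. Moreover, for all $x_0 \in X$ and $n_0 \in N$, the pointed mapping space $C^\infty((X,x_0),(N,n_0))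 = \{f \in C^\infty(X,N) : f(x_0) = n_0\}$, with the sub-diffeology from $C^\infty(X,N)$, is fibrant. In particular, for every smooth manifold $N$, the free loop space $C^\infty(S^1,N)$ and, for all $s_0 \in S^1$ and $n_0 \in N$, the based loop space $C^\infty((S^1,s_0),(N,n_0))$ are fibrant. -/

import Mathlib

open scoped Manifold ContDiff

namespace Diffeology

universe u v

/-- The sub-diffeology: a map into a subtype is a plot iff it is a plot of the ambient space. -/
instance instSubtype {X : Type u} [DiffeologicalSpace X] (P : X → Prop) :
    DiffeologicalSpace (Subtype P) where
  plots _ := {p | IsPlot fun t => (p t : X)}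
  constant_plots x := DiffeologicalSpace.constant_plots (x : X)
  plot_reparam hp hf := DiffeologicalSpace.plot_reparam hp hf
  locality hp := DiffeologicalSpace.locality hp

/-- The product diffeology: a map into the product is a plot iff both components are plots. -/
instance instProd {X : Type u} {Y : Type v} [DiffeologicalSpace X] [DiffeologicalSpace Y] :
    DiffeologicalSpace (X × Y) where
  plots _ := {p | IsPlot (fun t => (p t).1) ∧ IsPlot (fun t => (p t).2)}
  constant_plots x := ⟨isPlot_const, isPlot_const⟩
  plot_reparam hp hf := ⟨isPlot_reparam hp.1 hf, isPlot_reparam hp.2 hf⟩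
  locality hp := by
    refine ⟨DiffeologicalSpace.locality fun x => ?_, DiffeologicalSpace.locality fun x => ?_⟩
    · obtain ⟨u, hu, hx, h⟩ := hp x
      exact ⟨u, hu, hx, fun hfu hf => (h hfu hf).1⟩
    · obtain ⟨u, hu, hx, h⟩ := hp x
      exact ⟨u, hu, hx, fun hfu hf => (h hfu hf).2⟩

/-- The set `C^∞(X, Y)` of smooth maps between diffeological spaces. -/
@[ext]
structure SmoothMap (X : Type u) (Y : Type v) [DiffeologicalSpace X] [DiffeologicalSpace Y] where
  toFun : X → Y
  smooth : DSmooth toFun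

namespace SmoothMap

variable {X : Type u} {Y : Type v} [DiffeologicalSpace X] [DiffeologicalSpace Y]

instance : FunLike (SmoothMap X Y) X Y where
  coe := toFun
  coe_injective f g h := by cases f; cases g; congr

/-- The functional diffeology on `C^∞(X, Y)`: a map `p : ℝⁿ → C^∞(X, Y)` is a plot iff
`ℝⁿ × X → Y`, `(t, x) ↦ p t x`, is smooth. -/
instance : DiffeologicalSpace (SmoothMap X Y) where
  plots n := {p | DSmooth fun z : EuclideanSpace ℝ (Fin n) × X => p z.1 z.2}
  constant_plots f := fun _ _ hq => f.smooth _ _ hq.2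
  plot_reparam {n m p f} hp hf := fun k q hq =>
    hp k (fun t => (f (q t).1, (q t).2)) ⟨(hf.comp hq.1.contDiff).isPlot, hq.2⟩
  locality {n p} hp := by
    intro k q hq
    have hq1 : ContDiff ℝ ∞ fun t => (q t).1 := hq.1.contDiff
    refine DiffeologicalSpace.locality fun t => ?_
    obtain ⟨u, hu, hxu, h⟩ := hp (q t).1
    refine ⟨_, hu.preimage hq1.continuous, hxu, fun {m f} hfu hf => ?_⟩
    exact h (f := fun s => (q (f s)).1) hfu (hq1.comp hf) m (fun s => (s, (q (f s)).2))
      ⟨isPlot_id, isPlot_reparam hq.2 hf⟩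

end SmoothMap

/-- The pointed mapping space `C^∞((X, x₀), (Y, y₀))`; as a subtype of `C^∞(X, Y)` it carries the
sub-diffeology. -/
abbrev PointedSmoothMap (X : Type u) (Y : Type v) [DiffeologicalSpace X] [DiffeologicalSpace Y]
    (x₀ : X) (y₀ : Y) : Type (max u v) :=
  {f : SmoothMap X Y // f x₀ = y₀}

/-- The standard diffeology on a manifold modelled on `ℝᵈ`: the plots are the maps that are
smooth in the usual sense. -/
abbrev standardDiffeology (d : ℕ) (N : Type u) [TopologicalSpace N]
    [ChartedSpace (EuclideanSpace ℝ (Fin d)) N] : DiffeologicalSpace N :=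
  .ofCorePlotsOn {
    isPlotOn := fun {n u} _ p => ContMDiffOn (𝓡 n) (𝓡 d) ∞ p u
    isPlotOn_congr := fun _ _ _ h => contMDiffOn_congr h
    isPlot := fun {n} p => ContMDiff (𝓡 n) (𝓡 d) ∞ p
    isPlotOn_univ := contMDiffOn_univ
    isPlot_const := fun _ => contMDiff_const
    isPlotOn_reparam := fun _ _ _ h hp hf => hp.comp hf.contMDiffOn h
    locality := fun _ _ h => fun x hxu => by
      obtain ⟨v, hv, hxv, hv'⟩ := h x hxu
      exact ((hv' x hxv).contMDiffAt (hv.mem_nhds hxv)).contMDiffWithinAt }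

/-- The affine simplex `𝔸ⁿ = {x ∈ ℝⁿ⁺¹ | ∑ xᵢ = 1}`, with the sub-diffeology from `ℝⁿ⁺¹`. -/
abbrev AffineSimplex (n : ℕ) : Type :=
  {x : EuclideanSpace ℝ (Fin (n + 1)) // ∑ i, x i = 1}

namespace AffineSimplex

/-- The map `𝔸ᵐ → 𝔸ⁿ` induced by a map of vertices: `(f_* x)ⱼ = ∑_{f i = j} xᵢ`. -/
noncomputable def map {m n : ℕ} (f : Fin (m + 1) → Fin (n + 1)) (x : AffineSimplex m) :
    AffineSimplex n :=
  ⟨WithLp.toLp 2 fun j => ∑ i with f i = j, x.1 i, by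
    simpa [Finset.sum_fiberwise] using x.2⟩

theorem dSmooth_map {m n : ℕ} (f : Fin (m + 1) → Fin (n + 1)) : DSmooth (map f) := by
  intro k p hp
  have hp' : ContDiff ℝ ∞ fun t => (p t : EuclideanSpace ℝ (Fin (m + 1))) :=
    IsPlot.contDiff (show IsPlot fun t => (p t : EuclideanSpace ℝ (Fin (m + 1))) from hp)
  have h : ContDiff ℝ ∞ fun t => (map f (p t) : EuclideanSpace ℝ (Fin (n + 1))) := by
    rw [contDiff_euclidean] at hp' ⊢
    intro j
    exact ContDiff.sum (s := {i | f i = j}) (f := fun i t => (p t).1 i) fun i _ => hp' i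
  exact h.isPlot

theorem map_id {n : ℕ} (x : AffineSimplex n) : map id x = x := by
  ext j
  simp [map, Finset.sum_filter]

theorem map_map {l m n : ℕ} (g : Fin (m + 1) → Fin (n + 1)) (f : Fin (l + 1) → Fin (m + 1))
    (x : AffineSimplex l) : map g (map f x) = map (g ∘ f) x := by
  ext j
  simp only [map, Finset.sum_filter, Function.comp_apply]
  simp_rw [← Finset.sum_filter]
  rw [Finset.sum_sigma']
  refine Finset.sum_bij' (fun a _ => a.2) (fun i _ => ⟨f i, i⟩) ?_ ?_ ?_ ?_ ?_ <;> aesop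

end AffineSimplex

open CategoryTheory in
/-- The smooth singular simplicial set `S^D(X)`, with `S^D_n(X) = C^∞(𝔸ⁿ, X)` and simplicial
structure maps given by precomposition. -/
noncomputable def smoothSingular (X : Type u) [DiffeologicalSpace X] : SSet.{u} where
  obj Δ := SmoothMap (AffineSimplex Δ.unop.len) X
  map φ := ↾fun s =>
    { toFun := fun x => s (AffineSimplex.map (SimplexCategory.Hom.toOrderHom φ.unop) x)
      smooth := s.smooth.comp (AffineSimplex.dSmooth_map _) }
  map_id Δ := by
    ext s x
    exact congrArg s (AffineSimplex.map_id x)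
  map_comp φ ψ := by
    ext s x
    exact congrArg s (AffineSimplex.map_map (SimplexCategory.Hom.toOrderHom φ.unop)
      (SimplexCategory.Hom.toOrderHom ψ.unop) x).symm

open SSet.modelCategoryQuillen in
/-- A diffeological space `X` is fibrant if `S^D(X)` is a Kan complex. -/
def Fibrant (X : Type u) [DiffeologicalSpace X] : Prop :=
  SSet.KanComplex (smoothSingular X)

end Diffeology

/-!
A manifold admits a smooth rule `move x y z t` displacing `x` by `t` times the difference from `y`
to `z`, which takes `y` itself to `z` at time `1` if `y` and `z` are close: compose the rules given
by subtraction in charts, cut off by bump functions. If `X` is compact, pointwise displacement is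
such a rule on `C^∞(X, N)`, because close pairs of maps form a `D`-open set by a tube lemma, and it
preserves the pointed maps.

Any space with such a rule is fibrant. A horn prescribes smooth maps on coordinate hyperplanes, the
fixed spaces of commuting projections, and these are extended one hyperplane at a time. Given an
extension `w` from a union `L` of hyperplanes, and `g` prescribed on the fixed space of a further
projection `π`, displace `w` by the difference from `w ∘ π` to `g ∘ π`: this changes nothing on `L`
and gives `g` on the fixed space near `L`. Away from `L`, take `g ∘ π` instead. The transition
between the two is made by another displacement with a cut-off, so that a smooth map is obtained on
a neighbourhood of the union of `L` and the fixed space of `π`. As this union is star-shaped, the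
whole vector space is mapped smoothly into the neighbourhood by a map which fixes the union.
-/

open Set Function Topology Diffeology

section SmoothMaps

variable {X Y Z : Type*} [DiffeologicalSpace X] [DiffeologicalSpace Y] [DiffeologicalSpace Z]

theorem dSmooth_fst : DSmooth (Prod.fst : X × Y → X) := fun _ _ hp => hp.1

theorem dSmooth_snd : DSmooth (Prod.snd : X × Y → Y) := fun _ _ hp => hp.2

@[fun_prop]
theorem dSmooth_fst_comp {f : Z → X × Y} (hf : DSmooth f) : DSmooth fun z => (f z).1 :=
  dSmooth_fst.comp hf

@[fun_prop]
theorem dSmooth_snd_comp {f : Z → X × Y} (hf : DSmooth f) : DSmooth fun z => (f z).2 :=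
  dSmooth_snd.comp hf

@[fun_prop]
theorem dSmooth_prodMk {f : Z → X} {g : Z → Y} (hf : DSmooth f) (hg : DSmooth g) :
    DSmooth fun z => (f z, g z) :=
  fun n p hp => ⟨hf n p hp, hg n p hp⟩

@[fun_prop]
theorem dSmooth_subtype_val {P : X → Prop} : DSmooth (Subtype.val : Subtype P → X) :=
  fun _ _ hp => hp

@[fun_prop]
theorem dSmooth_subtype_mk {P : X → Prop} {f : Z → X} (hf : DSmooth f) (h : ∀ z, P (f z)) :
    DSmooth fun z => (⟨f z, h z⟩ : Subtype P) :=
  fun n p hp => hf n p hp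

@[fun_prop]
theorem dSmooth_eval {f : Z → SmoothMap X Y} {g : Z → X} (hf : DSmooth f) (hg : DSmooth g) :
    DSmooth fun z => f z (g z) :=
  fun n p hp => hf n p hp n (fun t => (t, g (p t))) ⟨isPlot_id, hg n p hp⟩

theorem dSmooth_of_uncurry {G : Z → SmoothMap X Y} (hG : DSmooth fun q : Z × X => G q.1 q.2) :
    DSmooth G :=
  fun _ p hp k q hq =>
    hG k (fun t => (p (q t).1, (q t).2)) ⟨isPlot_reparam hp hq.1.contDiff, hq.2⟩

theorem isOpen_dTopology_preimage {f : X → Y} (hf : DSmooth f) {S : Set Y}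
    (hS : IsOpen[dTopology] S) : IsOpen[dTopology] (f ⁻¹' S) :=
  continuous_def.1 hf.continuous S hS

theorem isOpen_dTopology_iff {E : Type*} [NormedAddCommGroup E] [NormedSpace ℝ E]
    [FiniteDimensional ℝ E] [DiffeologicalSpace E] [IsContDiffCompatible E] {S : Set E} :
    IsOpen[dTopology] S ↔ IsOpen S := by
  obtain rfl := NormedSpace.isContDiffCompatible_iff_eq_toDiffeology.1 ‹IsContDiffCompatible E›
  rfl

theorem dSmooth_of_locally_eqOn {F : X → Y}
    (h : ∀ x, ∃ S, IsOpen[dTopology] S ∧ x ∈ S ∧ ∃ G, DSmooth G ∧ EqOn F G S) : DSmooth F := by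
  intro n p hp
  refine DiffeologicalSpace.locality fun t => ?_
  obtain ⟨S, hS, htS, G, hG, hFG⟩ := h (p t)
  refine ⟨p ⁻¹' S, isOpen_iff_preimages_plots.1 hS n p hp, htS, fun {m f} hf hfc => ?_⟩
  have hFG' : (F ∘ p) ∘ f = G ∘ p ∘ f := funext fun s => hFG (hf s)
  exact hFG' ▸ hG m _ (isPlot_reparam hp hfc)

theorem dSmooth_piecewise {F G : X → Y} {S T : Set X} [∀ x, Decidable (x ∈ S)]
    (hF : DSmooth F) (hG : DSmooth G) (hS : IsOpen[dTopology] S) (hT : IsOpen[dTopology] T)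
    (hST : S ∪ T = univ) (hFG : EqOn F G (S ∩ T)) : DSmooth (S.piecewise F G) := by
  refine dSmooth_of_locally_eqOn fun x => (hST.symm ▸ mem_univ x : x ∈ S ∪ T).elim
    (fun hx => ⟨S, hS, hx, F, hF, S.piecewise_eqOn F G⟩)
    (fun hx => ⟨T, hT, hx, G, hG, fun y hyT => ?_⟩)
  by_cases hyS : y ∈ S
  · rw [piecewise_eq_of_mem _ _ _ hyS, hFG ⟨hyS, hyT⟩]
  · exact piecewise_eq_of_notMem _ _ _ hyS

end SmoothMaps

section Compactness

variable {U X : Type*} [DiffeologicalSpace U] [DiffeologicalSpace X] {m l : ℕ}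
  {p : EuclideanSpace ℝ (Fin m) → U}

theorem isOpen_preimage_prodMap {q : EuclideanSpace ℝ (Fin l) → X} {W : Set (U × X)}
    (hp : IsPlot p) (hq : IsPlot q) (hW : IsOpen[dTopology] W) :
    IsOpen (Prod.map p q ⁻¹' W) := by
  let e := toEuclidean (E := EuclideanSpace ℝ (Fin m) × EuclideanSpace ℝ (Fin l))
  have hpq : IsPlot (Prod.map p q ∘ e.symm) :=
    ⟨isPlot_reparam hp (contDiff_fst.comp e.symm.contDiff),
      isPlot_reparam hq (contDiff_snd.comp e.symm.contDiff)⟩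
  convert (isOpen_iff_preimages_plots.1 hW _ _ hpq).preimage e.continuous using 1
  ext z
  simp

theorem isOpen_setOf_forall_mem_of_isCompact {W : Set (U × X)} (hp : IsPlot p)
    (hW : IsOpen[dTopology] W) {K : Set (EuclideanSpace ℝ (Fin m))} (hK : IsCompact K) :
    IsOpen[dTopology] {x | ∀ t ∈ K, (p t, x) ∈ W} := by
  refine isOpen_iff_preimages_plots.2 fun l q hq => isOpen_iff_mem_nhds.2 fun s hs => ?_
  refine hK.eventually_forall_of_forall_eventually (P := fun s t => (p t, q s) ∈ W) fun t ht => ?_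
  exact (continuous_swap.tendsto (s, t)).eventually
    ((isOpen_preimage_prodMap hp hq hW).mem_nhds (hs t ht))

-- The D-topology of a product may be finer than the product of the D-topologies, so the
-- topological tube lemma does not apply; the balls supply the missing local compactness.
theorem isOpen_setOf_forall_prodMk_mem (hX : @CompactSpace X dTopology) {W : Set (U × X)}
    (hW : IsOpen[dTopology] W) : IsOpen[dTopology] {u | ∀ x, (u, x) ∈ W} := by
  let : TopologicalSpace X := dTopology
  refine isOpen_iff_preimages_plots.2 fun m p hp => isOpen_iff_mem_nhds.2 fun t₀ ht₀ => ?_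
  let K : ℕ → Set (EuclideanSpace ℝ (Fin m)) := fun k => Metric.closedBall t₀ (1 / ((k : ℝ) + 1))
  let O : ℕ → Set X := fun k => {x | ∀ t ∈ K k, (p t, x) ∈ W}
  have hO : ∀ k, IsOpen (O k) := fun k =>
    isOpen_setOf_forall_mem_of_isCompact hp hW (isCompact_closedBall _ _)
  have hmono : Monotone O := fun a b hab x hx t ht =>
    hx t (Metric.closedBall_subset_closedBall (Nat.one_div_le_one_div hab) ht)
  have hcover : univ ⊆ ⋃ k, O k := by
    intro x _
    have hslice : {t | (p t, x) ∈ W} ∈ 𝓝 t₀ :=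
      (isOpen_iff_preimages_plots.1 hW m (fun t => (p t, x)) ⟨hp, isPlot_const⟩).mem_nhds (ht₀ x)
    obtain ⟨ε, hε, hball⟩ := Metric.mem_nhds_iff.1 hslice
    obtain ⟨k, hk⟩ := exists_nat_one_div_lt hε
    exact mem_iUnion.2 ⟨k, fun t ht => hball (Metric.closedBall_subset_ball hk ht)⟩
  obtain ⟨k, hk⟩ := isCompact_univ.elim_directed_cover O hO hcover hmono.directed_le
  filter_upwards [Metric.closedBall_mem_nhds t₀ (Nat.one_div_pos_of_nat (n := k) (α := ℝ))]
    with t ht x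
  exact hk (mem_univ x) t ht

theorem compactSpace_dTopology_of_isPlot (hp : IsPlot p) {K : Set (EuclideanSpace ℝ (Fin m))}
    (hK : IsCompact K) (hpK : p '' K = univ) : @CompactSpace U dTopology :=
  @CompactSpace.mk U dTopology (hpK ▸ @IsCompact.image _ _ _ dTopology _ p hK hp.continuous)

theorem compactSpace_dTopology_circle :
    @CompactSpace Circle (@dTopology Circle (standardDiffeology 1 Circle)) := by
  let : DiffeologicalSpace Circle := standardDiffeology 1 Circle
  have hp : IsPlot fun t : EuclideanSpace ℝ (Fin 1) => Circle.exp (t 0) :=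
    contMDiff_circleExp.comp (contDiff_euclidean.1 contDiff_id 0).contMDiff
  refine compactSpace_dTopology_of_isPlot hp (isCompact_closedBall 0 Real.pi)
    (eq_univ_of_forall fun z => ⟨EuclideanSpace.single 0 (Complex.arg z), ?_, ?_⟩)
  · simpa using Complex.abs_arg_le_pi z
  · simp [Circle.exp_arg]

end Compactness

theorem exists_contDiff_mapsTo_eqOn_id {E : Type*} [NormedAddCommGroup E] [NormedSpace ℝ E]
    [FiniteDimensional ℝ E] {L V : Set E} {c : E} (hL : IsClosed L) (hcL : StarConvex ℝ c L)
    (hV : IsOpen V) (hcV : c ∈ V) (hLV : L ⊆ V) :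
    ∃ φ : E → E, ContDiff ℝ ∞ φ ∧ (∀ u, φ u ∈ V) ∧ EqOn φ id L := by
  let V' : Set E := {u | ∀ t ∈ Icc (0 : ℝ) 1, c + t • (u - c) ∈ V}
  have hV' : IsOpen V' := isOpen_iff_mem_nhds.2 fun u hu =>
    isCompact_Icc.eventually_forall_of_forall_eventually
      (P := fun u (t : ℝ) => c + t • (u - c) ∈ V) fun t ht =>
        ContinuousAt.preimage_mem_nhds (f := fun p : E × ℝ => c + p.2 • (p.1 - c)) (by fun_prop)
          (hV.mem_nhds (hu t ht))
  have hLV' : L ⊆ interior V' := by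
    rw [hV'.interior_eq]
    exact fun u hu t ht => hLV (hcL.add_smul_sub_mem hu ht.1 ht.2)
  obtain ⟨f, hf_one, hf_zero, hf_mem⟩ :=
    exists_contMDiffMap_one_nhds_of_subset_interior 𝓘(ℝ, E) (n := ⊤) hL hLV'
  have hf : ContDiff ℝ ∞ f := f.contMDiff.contDiff
  refine ⟨fun u => c + f u • (u - c), by fun_prop, fun u => ?_, fun u hu => ?_⟩
  · by_cases hu : u ∈ V'
    · exact hu _ (hf_mem u)
    · simpa [hf_zero u hu] using hcV
  · simp [hf_one.self_of_nhdsSet u hu]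

/-- A rule for moving the points of a diffeological space: `move x y z t` is `x` displaced by `t`
times the displacement that leads from `y` to `z`. That `y` itself then reaches `z` at time `1` is
not part of the structure; the pairs for which this holds stably are collected in `near`. -/
structure Displacement (Y : Type*) [DiffeologicalSpace Y] where
  move : Y → Y → Y → ℝ → Y
  dSmooth_move_uncurried : DSmooth fun q : Y × Y × Y × ℝ => move q.1 q.2.1 q.2.2.1 q.2.2.2
  move_zero : ∀ x y z, move x y z 0 = x
  move_self : ∀ x y t, move x y y t = x

namespace Displacement

variable {X Y Z : Type*} [DiffeologicalSpace X] [DiffeologicalSpace Y] [DiffeologicalSpace Z]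
  (σ τ : Displacement Y)

@[fun_prop]
theorem dSmooth_move {x y z : Z → Y} {t : Z → ℝ} (hx : DSmooth x) (hy : DSmooth y)
    (hz : DSmooth z) (ht : DSmooth t) : DSmooth fun w => τ.move (x w) (y w) (z w) (t w) :=
  τ.dSmooth_move_uncurried.comp (by fun_prop : DSmooth fun w => (x w, y w, z w, t w))

/-- The interior, for the D-topology of the product, of the set of pairs `(y, z)` such that the
displacement from `y` to `z` takes `y` to `z`. -/
def near : Set (Y × Y) := @interior _ dTopology {p | τ.move p.1 p.1 p.2 1 = p.2}

/-- A displacement is exact if it takes `y` to `z` for all pairs `(y, z)` close to the diagonal. -/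
def IsExact : Prop := ∀ y, (y, y) ∈ τ.near

theorem isOpen_near : IsOpen[dTopology] τ.near := @isOpen_interior _ dTopology _

theorem subset_near {S : Set (Y × Y)} (hS : IsOpen[dTopology] S)
    (h : ∀ p ∈ S, τ.move p.1 p.1 p.2 1 = p.2) : S ⊆ τ.near :=
  @interior_maximal _ dTopology _ _ h hS

variable {τ} in
theorem move_of_mem_near {y z : Y} (h : (y, z) ∈ τ.near) : τ.move y y z 1 = z :=
  @interior_subset _ dTopology {p : Y × Y | τ.move p.1 p.1 p.2 1 = p.2} _ h

section Composition

/-- The displacement that moves nothing, the unit for `Displacement.trans`. -/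
protected def refl (Y : Type*) [DiffeologicalSpace Y] : Displacement Y where
  move x _ _ _ := x
  dSmooth_move_uncurried := by fun_prop
  move_zero _ _ _ := rfl
  move_self _ _ _ := rfl

/-- Displace by `σ`, and then by what, according to `τ`, is missing to reach `z`. -/
protected def trans : Displacement Y where
  move x y z t := τ.move (σ.move x y z t) (σ.move y y z t) z t
  dSmooth_move_uncurried := by fun_prop
  move_zero x y z := by simp only [σ.move_zero, τ.move_zero]
  move_self x y t := by simp only [σ.move_self, τ.move_self]

theorem near_subset_near_trans : σ.near ⊆ (σ.trans τ).near :=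
  subset_near _ σ.isOpen_near fun p hp => by
    change τ.move (σ.move p.1 p.1 p.2 1) (σ.move p.1 p.1 p.2 1) p.2 1 = p.2
    rw [move_of_mem_near hp, τ.move_self]

variable {τ} in
theorem diag_mem_near_trans {y : Y} (hy : (y, y) ∈ τ.near) : (y, y) ∈ (σ.trans τ).near := by
  let missing : Y × Y → Y × Y := fun p => (σ.move p.1 p.1 p.2 1, p.2)
  have hmissing : IsOpen[dTopology] (missing ⁻¹' τ.near) :=
    isOpen_dTopology_preimage (by fun_prop) τ.isOpen_near
  refine subset_near _ hmissing (fun p hp => move_of_mem_near (y := σ.move p.1 p.1 p.2 1) hp) ?_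
  simpa only [missing, mem_preimage, σ.move_self] using hy

/-- The composition `S 0`, `S 1`, …, `S (n - 1)` of the first `n` members of a sequence. -/
def partialComp (S : ℕ → Displacement Y) : ℕ → Displacement Y
  | 0 => .refl Y
  | n + 1 => (partialComp S n).trans (S n)

theorem diag_mem_near_partialComp {S : ℕ → Displacement Y} {n : ℕ} {y : Y}
    (hy : (y, y) ∈ (S n).near) : ∀ m > n, (y, y) ∈ (partialComp S m).near :=
  Nat.le_induction (diag_mem_near_trans _ hy) fun _ _ ih => near_subset_near_trans _ _ ih

/-- No point is displaced in the direction of `z`. -/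
def IsTrivialAt (z : Y) : Prop := ∀ x y t, τ.move x y z t = x

theorem partialComp_move_eq_of_isTrivialAt {S : ℕ → Displacement Y} {z : Y} {A : ℕ}
    (hS : ∀ n ≥ A, (S n).IsTrivialAt z) {n : ℕ} (hn : A ≤ n) (x y : Y) (t : ℝ) :
    (partialComp S n).move x y z t = (partialComp S A).move x y z t := by
  induction n, hn using Nat.le_induction with
  | base => rfl
  | succ n hn ih => exact (hS n hn _ _ _).trans ih

theorem exists_locally_eq_partialComp {S : ℕ → Displacement Y}
    (hS : ∀ z₀, ∃ O, IsOpen[dTopology] O ∧ z₀ ∈ O ∧ ∃ A, ∀ n ≥ A, ∀ z ∈ O, (S n).IsTrivialAt z) :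
    ∃ τ : Displacement Y, ∀ z₀, ∃ O, IsOpen[dTopology] O ∧ z₀ ∈ O ∧ ∃ A, ∀ n ≥ A, ∀ z ∈ O,
      ∀ x y t, τ.move x y z t = (partialComp S n).move x y z t := by
  choose O hO hmem A hA using hS
  let move (x y z : Y) (t : ℝ) : Y := (partialComp S (A z)).move x y z t
  have move_eq (z₀ : Y) {n : ℕ} (hn : A z₀ ≤ n) {z : Y} (hz : z ∈ O z₀) (x y : Y) (t : ℝ) :
      move x y z t = (partialComp S n).move x y z t := by
    rw [partialComp_move_eq_of_isTrivialAt (fun k hk => hA z₀ k hk z hz) hn,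
      ← partialComp_move_eq_of_isTrivialAt (fun k hk => hA z₀ k hk z hz) (le_max_right (A z) _),
      partialComp_move_eq_of_isTrivialAt (fun k hk => hA z k hk z (hmem z)) (le_max_left _ _)]
  refine ⟨⟨move, ?_, fun x y z => move_zero _ x y z, fun x y t => move_self _ x y t⟩,
    fun z₀ => ⟨O z₀, hO z₀, hmem z₀, A z₀, fun n hn z hz => move_eq z₀ hn hz⟩⟩
  exact dSmooth_of_locally_eqOn fun q₀ =>
    ⟨(fun q : Y × Y × Y × ℝ => q.2.2.1) ⁻¹' O q₀.2.2.1,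
      isOpen_dTopology_preimage (by fun_prop) (hO _), hmem _, _,
      (partialComp S (A q₀.2.2.1)).dSmooth_move_uncurried,
      fun q hq => move_eq _ le_rfl hq _ _ _⟩

theorem exists_isExact_of_locallyFinite {ι : Type*} [Countable ι] (S : ι → Displacement Y)
    (hS : ∀ z₀, ∃ O, IsOpen[dTopology] O ∧ z₀ ∈ O ∧ {i | ∃ z ∈ O, ¬ (S i).IsTrivialAt z}.Finite)
    (hS_near : ∀ y, ∃ i, (y, y) ∈ (S i).near) : ∃ τ : Displacement Y, τ.IsExact := by
  obtain ⟨f, hf⟩ := exists_injective_nat ι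
  let S' : ℕ → Displacement Y := extend f S fun _ => .refl Y
  have hS' : ∀ z₀, ∃ O, IsOpen[dTopology] O ∧ z₀ ∈ O ∧
      ∃ A, ∀ n ≥ A, ∀ z ∈ O, (S' n).IsTrivialAt z := by
    intro z₀
    obtain ⟨O, hO, hzO, hfin⟩ := hS z₀
    obtain ⟨A, hA⟩ := (hfin.image f).bddAbove
    refine ⟨O, hO, hzO, A + 1, fun n hn z hz => ?_⟩
    by_cases hn_range : ∃ i, f i = n
    · obtain ⟨i, rfl⟩ := hn_range
      rw [show S' (f i) = S i from hf.extend_apply _ _ _]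
      by_contra hi
      exact absurd (hA (mem_image_of_mem f ⟨z, hz, hi⟩)) (by lia)
    · rw [show S' n = .refl Y from extend_apply' _ _ _ hn_range]
      exact fun _ _ _ => rfl
  obtain ⟨τ, hτ⟩ := exists_locally_eq_partialComp hS'
  refine ⟨τ, fun y => ?_⟩
  obtain ⟨O, hO, hyO, A, hA⟩ := hτ y
  obtain ⟨i, hi⟩ := hS_near y
  let n := max A (f i + 1)
  have hn : (y, y) ∈ (partialComp S' n).near :=
    diag_mem_near_partialComp (n := f i) (by simpa only [S', hf.extend_apply] using hi)
      n (by lia)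
  refine τ.subset_near (@IsOpen.inter _ dTopology _ _ (partialComp S' n).isOpen_near
    (isOpen_dTopology_preimage dSmooth_snd hO)) (fun p hp => ?_) ⟨hn, hyO⟩
  rw [hA n (le_max_left _ _) _ hp.2, move_of_mem_near hp.1]

end Composition

section MappingSpaces

/-- The pointwise displacement of smooth maps into `Y`. -/
def mapping (X : Type*) [DiffeologicalSpace X] : Displacement (SmoothMap X Y) where
  move f g h t := ⟨fun x => τ.move (f x) (g x) (h x) t, by fun_prop⟩
  dSmooth_move_uncurried := dSmooth_of_uncurry <| by
    change DSmooth fun q : (SmoothMap X Y × SmoothMap X Y × SmoothMap X Y × ℝ) × X =>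
      τ.move (q.1.1 q.2) (q.1.2.1 q.2) (q.1.2.2.1 q.2) q.1.2.2.2
    fun_prop
  move_zero f g h := SmoothMap.ext <| funext fun _ => τ.move_zero _ _ _
  move_self f g t := SmoothMap.ext <| funext fun _ => τ.move_self _ _ _

/-- The displacement of a subspace which is stable under moving its points. -/
def restrict (P : Y → Prop) (hP : ∀ x y z t, P x → P y → P z → P (τ.move x y z t)) :
    Displacement (Subtype P) where
  move x y z t := ⟨τ.move x y z t, hP x y z t x.2 y.2 z.2⟩
  dSmooth_move_uncurried := by fun_prop
  move_zero x y z := Subtype.ext <| τ.move_zero _ _ _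
  move_self x y t := Subtype.ext <| τ.move_self _ _ _

variable {τ}

theorem IsExact.mapping (hτ : τ.IsExact) (hX : @CompactSpace X dTopology) :
    (τ.mapping X).IsExact := by
  intro f
  let W : Set ((SmoothMap X Y × SmoothMap X Y) × X) := {q | (q.1.1 q.2, q.1.2 q.2) ∈ τ.near}
  have hW : IsOpen[dTopology] W :=
    isOpen_dTopology_preimage (f := fun q : (SmoothMap X Y × SmoothMap X Y) × X =>
      (q.1.1 q.2, q.1.2 q.2)) (by fun_prop) τ.isOpen_near
  exact (τ.mapping X).subset_near (isOpen_setOf_forall_prodMk_mem hX hW)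
    (fun p hp => SmoothMap.ext <| funext fun x => move_of_mem_near (hp x)) fun x => hτ (f x)

theorem IsExact.restrict (hτ : τ.IsExact) {P : Y → Prop}
    (hP : ∀ x y z t, P x → P y → P z → P (τ.move x y z t)) : (τ.restrict P hP).IsExact := by
  have hnear : IsOpen[dTopology] ((fun p : Subtype P × Subtype P => (p.1.1, p.2.1)) ⁻¹' τ.near) :=
    isOpen_dTopology_preimage (by fun_prop) τ.isOpen_near
  exact fun y => (τ.restrict P hP).subset_near hnear
    (fun p hp => Subtype.ext <| move_of_mem_near (τ := τ) hp) (hτ y.1)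

end MappingSpaces

end Displacement

section Manifolds

theorem exists_displacement_of_localRetract {Y E : Type*} [DiffeologicalSpace Y]
    [NormedAddCommGroup E] [NormedSpace ℝ E] [DiffeologicalSpace E] [IsContDiffCompatible E]
    {φ : Y → E} {ψ : E → Y} {χ : Y → ℝ} {U K : Set Y} (hφ : DSmooth φ) (hψ : DSmooth ψ)
    (hχ : DSmooth χ) (hU : IsOpen[dTopology] U) (hψφ : ∀ x ∈ U, ψ (φ x) = x)
    (hK : IsOpen[dTopology] Kᶜ) (hKU : K ⊆ U) (hχK : ∀ x ∉ K, χ x = 0) :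
    ∃ τ : Displacement Y, (∀ z, χ z = 0 → τ.IsTrivialAt z) ∧
      ∀ y z, χ y = 1 → χ z = 1 → τ.move y y z 1 = z := by
  classical
  let translate : Y × Y × Y × ℝ → E := fun q =>
    φ q.1 + (q.2.2.2 * χ q.1 * χ q.2.1 * χ q.2.2.1) • (φ q.2.2.1 - φ q.2.1)
  have htranslate : DSmooth translate := fun n p hp => by
    have hφ₁ := (hφ n _ hp.1).contDiff
    have hφ₂ := (hφ n _ hp.2.1).contDiff
    have hφ₃ := (hφ n _ hp.2.2.1).contDiff
    have hχ₁ := (hχ n _ hp.1).contDiff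
    have hχ₂ := (hχ n _ hp.2.1).contDiff
    have hχ₃ := (hχ n _ hp.2.2.1).contDiff
    exact ContDiff.isPlot (hφ₁.add ((((hp.2.2.2.contDiff.mul hχ₁).mul hχ₂).mul hχ₃).smul
      (hφ₃.sub hφ₂)))
  have hψ_translate (q : Y × Y × Y × ℝ) (hqU : q.1 ∈ U)
      (hq : q.2.2.2 * χ q.1 * χ q.2.1 * χ q.2.2.1 = 0 ∨ q.2.1 = q.2.2.1) :
      ψ (translate q) = q.1 := by
    rcases hq with hq | hq <;> simp [translate, hq, hψφ _ hqU]
  let move (x y z : Y) (t : ℝ) : Y := if x ∈ U then ψ (translate (x, y, z, t)) else x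
  have hmove : DSmooth fun q : Y × Y × Y × ℝ => move q.1 q.2.1 q.2.2.1 q.2.2.2 :=
    dSmooth_piecewise (S := Prod.fst ⁻¹' U) (T := Prod.fst ⁻¹' Kᶜ) (hψ.comp htranslate) dSmooth_fst
      (isOpen_dTopology_preimage dSmooth_fst hU) (isOpen_dTopology_preimage dSmooth_fst hK)
      (compl_subset_iff_union.1 <| compl_subset_compl.2 fun q hq => hKU hq)
      fun q hq => hψ_translate q hq.1 (by simp [hχK _ hq.2])
  have move_eq (x y z : Y) (t : ℝ) (h : t * χ x * χ y * χ z = 0 ∨ y = z) : move x y z t = x := by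
    by_cases hx : x ∈ U
    · exact (if_pos hx).trans (hψ_translate (x, y, z, t) hx h)
    · exact if_neg hx
  refine ⟨⟨move, hmove, fun x y z => move_eq _ _ _ _ (by simp),
    fun x y t => move_eq _ _ _ _ (.inr rfl)⟩, fun z hz x y t => move_eq _ _ _ _ (by simp [hz]),
    fun y z hy hz => ?_⟩
  have mem_of_eq_one {x : Y} (hx : χ x = 1) : x ∈ U :=
    hKU <| by_contra fun hxK => one_ne_zero (hx.symm.trans (hχK x hxK))
  simp [move, translate, mem_of_eq_one hy, hy, hz, hψφ z (mem_of_eq_one hz)]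

variable {d : ℕ} {N : Type*} [TopologicalSpace N] [ChartedSpace (EuclideanSpace ℝ (Fin d)) N]

theorem exists_contMDiff_localRetract [IsManifold (𝓡 d) ∞ N] [T2Space N] (c : N) :
    ∃ (φ : N → EuclideanSpace ℝ (Fin d)) (ψ : EuclideanSpace ℝ (Fin d) → N),
      ContMDiff (𝓡 d) (𝓡 d) ∞ φ ∧ ContMDiff (𝓡 d) (𝓡 d) ∞ ψ ∧ ∀ᶠ x in 𝓝 c, ψ (φ x) = x := by
  let e := chartAt (EuclideanSpace ℝ (Fin d)) c
  obtain ⟨f⟩ : Nonempty (SmoothBumpFunction (𝓡 d) c) := inferInstance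
  have hc : e.source ∈ 𝓝 c := chart_source_mem_nhds _ c
  have hec : e c ∈ e.target := mem_chart_target _ c
  obtain ⟨R, hR, hball⟩ := Metric.nhds_basis_closedBall.mem_iff.1 (e.open_target.mem_nhds hec)
  obtain ⟨ρ, hρ, hρ_mem, hρ_id⟩ := exists_contDiff_mapsTo_eqOn_id Metric.isClosed_closedBall
    ((convex_closedBall _ _).starConvex (Metric.mem_closedBall_self hR.le)) e.open_target hec hball
  refine ⟨fun x => f x • e x, e.symm ∘ ρ, f.contMDiff_smul contMDiffOn_chart,
    contMDiffOn_chart_symm.comp_contMDiff hρ.contMDiff hρ_mem, ?_⟩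
  filter_upwards [hc, f.eventuallyEq_one,
    (e.continuousAt (mem_chart_source _ c)).preimage_mem_nhds (Metric.closedBall_mem_nhds _ hR)]
    with x hx hfx hxR
  simp [hfx, hρ_id hxR, e.left_inv hx]

theorem isOpen_dTopology_standardDiffeology {S : Set N} (hS : IsOpen S) :
    IsOpen[@dTopology N (standardDiffeology d N)] S :=
  @isOpen_iff_preimages_plots N (standardDiffeology d N) S |>.2 fun n _ hp =>
    hS.preimage (ContMDiff.continuous (I := 𝓡 n) (I' := 𝓡 d) (n := ∞) hp)

theorem exists_isExact_displacement (d : ℕ) (N : Type*) [TopologicalSpace N]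
    [ChartedSpace (EuclideanSpace ℝ (Fin d)) N] [IsManifold (𝓡 d) ∞ N] [T2Space N]
    [SecondCountableTopology N] :
    letI : DiffeologicalSpace N := standardDiffeology d N
    ∃ τ : Displacement N, τ.IsExact := by
  let : DiffeologicalSpace N := standardDiffeology d N
  have : LocallyCompactSpace N := ChartedSpace.locallyCompactSpace (EuclideanSpace ℝ (Fin d)) N
  choose φ ψ hφ hψ hψφ using exists_contMDiff_localRetract (d := d) (N := N)
  let U (c : N) : Set N := interior {x | ψ c (φ c x) = x}
  obtain ⟨ι, f, hf⟩ := SmoothBumpCovering.exists_isSubordinate (𝓡 d) (s := (univ : Set N))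
    isClosed_univ (U := U) fun c _ => interior_mem_nhds.2 (hψφ c)
  have : Countable ι := countable_univ_iff.1 <|
    f.locallyFinite.countable_univ fun i => ⟨f.c i, by simp [mem_support]⟩
  choose τ hτ_trivial hτ_exact using fun i => exists_displacement_of_localRetract
    (χ := f i) (U := U (f.c i)) (K := tsupport (f i))
    (fun _ _ hp => ((hφ (f.c i)).comp hp).contDiff.isPlot)
    (fun _ _ hp => (hψ (f.c i)).comp hp.contDiff.contMDiff)
    (fun _ _ hp => ((f i).contMDiff.comp hp).contDiff.isPlot)
    (isOpen_dTopology_standardDiffeology isOpen_interior) (interior_subset (s := {x | _}))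
    (isOpen_dTopology_standardDiffeology (isClosed_tsupport _).isOpen_compl) (hf i)
    fun x hx => image_eq_zero_of_notMem_tsupport hx
  refine Displacement.exists_isExact_of_locallyFinite τ (fun z₀ => ?_) fun y => ?_
  · obtain ⟨Z, hZ, hZ_fin⟩ := f.locallyFinite z₀
    refine ⟨interior Z, isOpen_dTopology_standardDiffeology isOpen_interior,
      mem_interior_iff_mem_nhds.2 hZ, hZ_fin.subset fun i => ?_⟩
    rintro ⟨z, hz, hiz⟩
    exact ⟨z, fun h => hiz (hτ_trivial i z h), interior_subset hz⟩
  · obtain ⟨W, hW_one, hW, hyW⟩ := eventually_nhds_iff.1 (f.eventuallyEq_one y (mem_univ y))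
    have hW' := isOpen_dTopology_standardDiffeology (d := d) hW
    refine ⟨f.ind y (mem_univ y), (τ _).subset_near (S := Prod.fst ⁻¹' W ∩ Prod.snd ⁻¹' W)
      (@IsOpen.inter _ dTopology _ _ (isOpen_dTopology_preimage dSmooth_fst hW')
        (isOpen_dTopology_preimage dSmooth_snd hW')) (fun p hp => ?_) ⟨hyW, hyW⟩⟩
    exact hτ_exact _ _ _ (hW_one _ hp.1) (hW_one _ hp.2)

end Manifolds

theorem starConvex_zero_fixedPoints {E F : Type*} [AddCommGroup E] [Module ℝ E] [FunLike F E E]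
    [LinearMapClass F ℝ E E] (π : F) : StarConvex ℝ 0 (fixedPoints π) :=
  starConvex_zero_iff.2 fun u hu t _ _ => by
    rw [mem_fixedPoints_iff, map_smul, mem_fixedPoints_iff.1 hu]

section Extension

variable {Y E : Type*} [DiffeologicalSpace Y] [NormedAddCommGroup E] [NormedSpace ℝ E]
  [FiniteDimensional ℝ E] [DiffeologicalSpace E] [IsContDiffCompatible E]

theorem exists_dSmooth_eqOn_of_starConvex {F₁ F₂ : E → Y} {L H V₁ V₂ : Set E} {c : E}
    (hF₁ : DSmooth F₁) (hF₂ : DSmooth F₂) (hL : IsClosed L) (hH : IsClosed H)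
    (hcL : StarConvex ℝ c L) (hcH : StarConvex ℝ c H) (hV₁ : IsOpen V₁) (hV₂ : IsOpen V₂)
    (hc : c ∈ V₁ ∪ V₂) (hLV₁ : L ⊆ V₁) (hHV₂ : H ⊆ V₂) (hF : EqOn F₁ F₂ (V₁ ∩ V₂)) :
    ∃ F : E → Y, DSmooth F ∧ EqOn F F₁ L ∧ EqOn F F₂ H := by
  classical
  obtain ⟨φ, hφ, hφV, hφ_id⟩ := exists_contDiff_mapsTo_eqOn_id (hL.union hH) (hcL.union hcH)
    (hV₁.union hV₂) hc (union_subset_union hLV₁ hHV₂)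
  have hφ' : DSmooth φ := hφ.dSmooth
  refine ⟨(φ ⁻¹' V₁).piecewise (F₁ ∘ φ) (F₂ ∘ φ), ?_, fun u hu => ?_, fun u hu => ?_⟩
  · exact dSmooth_piecewise (T := φ ⁻¹' V₂) (hF₁.comp hφ') (hF₂.comp hφ')
      (isOpen_dTopology_iff.2 (hV₁.preimage hφ.continuous))
      (isOpen_dTopology_iff.2 (hV₂.preimage hφ.continuous)) (eq_univ_of_forall hφV)
      fun u hu => hF hu
  · have hφu : φ u = u := hφ_id (.inl hu)
    simp [piecewise, hφu, hLV₁ hu]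
  · have hφu : φ u = u := hφ_id (.inr hu)
    by_cases hu₁ : u ∈ V₁
    · simp [piecewise, hφu, hu₁, hF ⟨hu₁, hHV₂ hu⟩]
    · simp [piecewise, hφu, hu₁]

namespace Displacement.IsExact

variable {τ : Displacement Y} {w g : E → Y} {π : E →L[ℝ] E}

theorem exists_eqOn_eqOn_inter_fixedPoints (hτ : τ.IsExact) {L : Set E} (hπ : IsIdempotentElem π)
    (hπL : MapsTo π L L) (hw : DSmooth w) (hg : DSmooth g) (hwg : EqOn w g (L ∩ fixedPoints π)) :
    ∃ F : E → Y, DSmooth F ∧ EqOn F w L ∧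
      ∃ Q, IsOpen Q ∧ L ∩ fixedPoints π ⊆ Q ∧ EqOn F g (Q ∩ fixedPoints π) := by
  have hπ' : DSmooth π := π.contDiff.dSmooth
  refine ⟨fun u => τ.move (w u) (w (π u)) (g (π u)) 1,
    τ.dSmooth_move hw (hw.comp hπ') (hg.comp hπ') dSmooth_const, fun u hu => ?_,
    (fun v => (w v, g v)) ⁻¹' τ.near, ?_, fun v hv => ?_, fun v ⟨hvQ, hv⟩ => ?_⟩
  · have hπu : π u ∈ fixedPoints π := DFunLike.congr_fun hπ.eq u
    simp only [hwg ⟨hπL hu, hπu⟩, τ.move_self]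
  · exact isOpen_dTopology_iff.1 (isOpen_dTopology_preimage (dSmooth_prodMk hw hg) τ.isOpen_near)
  · rw [mem_preimage, hwg hv]
    exact hτ _
  · simp only [mem_fixedPoints_iff.1 hv, move_of_mem_near hvQ]

theorem exists_eqOn_fixedPoints_eqOn_inter (hτ : τ.IsExact) {F₁ : E → Y} {C Q : Set E}
    (hC : IsClosed C) (hQ : IsOpen Q) (hCQ : C ⊆ Q) (hF₁ : DSmooth F₁) (hg : DSmooth g)
    (hF₁g : EqOn F₁ g (Q ∩ fixedPoints π)) :
    ∃ F₂ : E → Y, DSmooth F₂ ∧ EqOn F₂ g (fixedPoints π) ∧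
      ∃ V₁ V₂, IsOpen V₁ ∧ IsOpen V₂ ∧ π ⁻¹' C ⊆ V₁ ∧ fixedPoints π ⊆ V₂ ∧
        EqOn F₁ F₂ (V₁ ∩ V₂) := by
  have hgπ : DSmooth fun u => g (π u) := hg.comp π.contDiff.dSmooth
  obtain ⟨β, hβ_one, hβ_zero, -⟩ := exists_contMDiffMap_one_nhds_of_subset_interior
    𝓘(ℝ, E) (n := ⊤) hC (hCQ.trans_eq hQ.interior_eq.symm)
  have hβπ : ContDiff ℝ ∞ fun u => β (π u) := β.contMDiff.contDiff.comp π.contDiff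
  let N : Set E := {u | (g (π u), F₁ u) ∈ τ.near}
  have hN : IsOpen N :=
    isOpen_dTopology_iff.1 (isOpen_dTopology_preimage (dSmooth_prodMk hgπ hF₁) τ.isOpen_near)
  refine ⟨fun u => τ.move (g (π u)) (g (π u)) (F₁ u) (β (π u)),
    τ.dSmooth_move hgπ hgπ hF₁ hβπ.dSmooth, fun u hu => ?_, π ⁻¹' interior {v | β v = 1},
    {u | β (π u) ≠ 1} ∪ N, isOpen_interior.preimage π.continuous,
    (isOpen_ne.preimage hβπ.continuous).union hN,
    preimage_mono (subset_interior_iff_mem_nhdsSet.2 hβ_one), fun u hu => ?_, ?_⟩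
  · have hπu := mem_fixedPoints_iff.1 hu
    by_cases huQ : u ∈ Q
    · simp only [hπu, hF₁g ⟨huQ, hu⟩, τ.move_self]
    · simp only [hπu, hβ_zero u huQ, τ.move_zero]
  · have hπu := mem_fixedPoints_iff.1 hu
    by_cases huQ : u ∈ Q
    · have huN : (g (π u), F₁ u) ∈ τ.near := by simpa only [hπu, hF₁g ⟨huQ, hu⟩] using hτ (g u)
      exact .inr huN
    · exact .inl (by simp [hπu, hβ_zero u huQ])
  · rintro u ⟨hu₁, hu₂⟩
    have hβu : β (π u) = 1 := interior_subset (s := {v : E | β v = 1}) hu₁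
    have huN : u ∈ N := hu₂.resolve_left fun h => h hβu
    simp only [hβu, move_of_mem_near huN]

theorem exists_eqOn_union_fixedPoints (hτ : τ.IsExact) {L : Set E} (hL : IsClosed L)
    (hL₀ : StarConvex ℝ 0 L) (hπ : IsIdempotentElem π) (hπL : MapsTo π L L) (hw : DSmooth w)
    (hg : DSmooth g) (hwg : EqOn w g (L ∩ fixedPoints π)) :
    ∃ F : E → Y, DSmooth F ∧ EqOn F w L ∧ EqOn F g (fixedPoints π) := by
  have hπ_closed : IsClosed (fixedPoints π) := isClosed_fixedPoints π.continuous
  obtain ⟨F₁, hF₁, hF₁w, Q, hQ, hLQ, hF₁g⟩ := hτ.exists_eqOn_eqOn_inter_fixedPoints hπ hπL hw hg hwg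
  obtain ⟨F₂, hF₂, hF₂g, V₁, V₂, hV₁, hV₂, hCV₁, hπV₂, hF₁₂⟩ :=
    hτ.exists_eqOn_fixedPoints_eqOn_inter (hL.inter hπ_closed) hQ hLQ hF₁ hg hF₁g
  have hLV₁ : L ⊆ V₁ := fun u hu => hCV₁ ⟨hπL hu, DFunLike.congr_fun hπ.eq u⟩
  obtain ⟨F, hF, hFF₁, hFF₂⟩ := exists_dSmooth_eqOn_of_starConvex hF₁ hF₂ hL hπ_closed hL₀
    (starConvex_zero_fixedPoints π) hV₁ hV₂ (.inr (hπV₂ (map_zero π))) hLV₁ hπV₂ hF₁₂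
  exact ⟨F, hF, hFF₁.trans hF₁w, hFF₂.trans hF₂g⟩

theorem exists_eqOn_fixedPoints [Nonempty Y] (hτ : τ.IsExact) {J : Type*} [Finite J]
    {π : J → E →L[ℝ] E} (hπ : ∀ j, IsIdempotentElem (π j)) (hπ_comm : ∀ j k, Commute (π j) (π k))
    {f : J → E → Y} (hf : ∀ j, DSmooth (f j))
    (hf_compat : ∀ j k, EqOn (f j) (f k) (fixedPoints (π j) ∩ fixedPoints (π k))) :
    ∃ F : E → Y, DSmooth F ∧ ∀ j, EqOn F (f j) (fixedPoints (π j)) := by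
  classical
  have := Fintype.ofFinite J
  suffices h : ∀ s : Finset J,
      ∃ F : E → Y, DSmooth F ∧ ∀ j ∈ s, EqOn F (f j) (fixedPoints (π j)) by
    simpa using h Finset.univ
  intro s
  induction s using Finset.induction_on with
  | empty => exact ⟨fun _ => Classical.arbitrary Y, dSmooth_const, by simp⟩
  | insert k s _ ih =>
    obtain ⟨w, hw, hwf⟩ := ih
    let L : Set E := ⋃ j ∈ s, fixedPoints (π j)
    have hL : IsClosed L :=
      s.finite_toSet.isClosed_biUnion fun j _ => isClosed_fixedPoints (π j).continuous
    have hL₀ : StarConvex ℝ 0 L := starConvex_iUnion₂ fun j _ => starConvex_zero_fixedPoints (π j)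
    have hkL : MapsTo (π k) L L := mapsTo_iUnion₂_iUnion₂ fun j _ =>
      Semiconj.mapsTo_fixedPoints fun u => DFunLike.congr_fun (hπ_comm k j).eq u
    have hwk : EqOn w (f k) (L ∩ fixedPoints (π k)) := by
      rintro u ⟨hu, huk⟩
      obtain ⟨j, hj, huj⟩ := mem_iUnion₂.1 hu
      rw [hwf j hj huj, hf_compat j k ⟨huj, huk⟩]
    obtain ⟨F, hF, hFw, hFk⟩ :=
      hτ.exists_eqOn_union_fixedPoints hL hL₀ (hπ k) hkL hw (hf k) hwk
    refine ⟨F, hF, Finset.forall_mem_insert _ _ _ |>.2 ⟨hFk, fun j hj u hu => ?_⟩⟩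
    rw [hFw (mem_biUnion hj hu), hwf j hj hu]

end Displacement.IsExact

end Extension

section Horns

/-- A compatible family of simplices `σ j`, `j ≠ i`, that is, a horn in `S^D(Y)` omitting its `i`-th
face. Compatibility is required for all the common faces of the `j`-th and `k`-th faces, presented
by monotone vertex maps, so that no case distinction between `j < k` and `k < j` is needed. -/
def IsHorn {Y : Type*} [DiffeologicalSpace Y] {n : ℕ} (i : Fin (n + 2))
    (σ : ∀ j, j ≠ i → SmoothMap (AffineSimplex n) Y) : Prop :=
  ∀ j k hj hk (m : ℕ) (a b : Fin (m + 1) →o Fin (n + 1)),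
    (∀ p, j.succAbove (a p) = k.succAbove (b p)) →
      ∀ v, σ j hj (AffineSimplex.map a v) = σ k hk (AffineSimplex.map b v)

open CategoryTheory Opposite Simplicial in
theorem fibrant_of_forall_isHorn {Y : Type*} [DiffeologicalSpace Y]
    (h : ∀ (n : ℕ) (i : Fin (n + 2)) (σ : ∀ j, j ≠ i → SmoothMap (AffineSimplex n) Y),
      IsHorn i σ → ∃ ρ : SmoothMap (AffineSimplex (n + 1)) Y,
        ∀ j hj v, ρ (AffineSimplex.map j.succAbove v) = σ j hj v) :
    Fibrant Y := by
  refine SSet.KanComplex.iff.2 fun n i f hf => ?_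
  have map_comp_eq (j k : Fin (n + 2)) (hj : j ≠ i) (hk : k ≠ i) (m : ℕ) (a b : ⦋m⦌ ⟶ ⦋n⦌)
      (hab : a ≫ SimplexCategory.δ j = b ≫ SimplexCategory.δ k) :
      SSet.stdSimplex.map a ≫ f j hj = SSet.stdSimplex.map b ≫ f k hk := by
    rw [← hf.ι_desc j hj, ← hf.ι_desc k hk, ← Category.assoc, ← Category.assoc]
    congr 1
    rw [← cancel_mono (SSet.Subcomplex.ι _), Category.assoc, Category.assoc, SSet.horn.ι_ι,
      SSet.horn.ι_ι]
    exact (SSet.stdSimplex.map_comp a (SimplexCategory.δ j)).symm.trans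
      ((congrArg SSet.stdSimplex.map hab).trans
        (SSet.stdSimplex.map_comp b (SimplexCategory.δ k)))
  have isHorn_faces : IsHorn i fun j hj => SSet.yonedaEquiv (f j hj) := by
    intro j k hj hk m a b hab v
    have hδ : SimplexCategory.Hom.mk a ≫ SimplexCategory.δ j =
        SimplexCategory.Hom.mk b ≫ SimplexCategory.δ k := by
      ext p : 3
      exact hab p
    have hyoneda := congrArg SSet.yonedaEquiv (map_comp_eq j k hj hk m _ _ hδ)
    rw [← SSet.yonedaEquiv_naturality, ← SSet.yonedaEquiv_naturality] at hyoneda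
    exact congrArg (fun s : SmoothMap (AffineSimplex m) Y => s v) hyoneda
  obtain ⟨ρ, hρ⟩ := h n i _ isHorn_faces
  refine ⟨SSet.yonedaEquiv.symm (show (smoothSingular Y).obj (op ⦋n + 1⦌) from ρ), fun j hj => ?_⟩
  apply SSet.yonedaEquiv.injective
  refine (SSet.yonedaEquiv_naturality (SimplexCategory.δ j) _).symm.trans ?_
  rw [Equiv.apply_symm_apply]
  exact SmoothMap.ext (funext fun v => hρ j hj v)

theorem exists_orderHom_mem_and_eqOn_id {α : Type*} [LinearOrder α] {C : Finset α}
    (hC : C.Nonempty) : ∃ e : α →o α, (∀ p, e p ∈ C) ∧ EqOn e id C := by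
  let m := C.min' hC
  refine ⟨⟨fun p => C.sup' hC fun c => if c ≤ p then c else m, fun p q hpq => ?_⟩, fun p => ?_,
    fun p hp => le_antisymm (Finset.sup'_le hC _ fun c _ => ?_) ?_⟩
  · refine Finset.sup'_mono_fun fun c hc => ?_
    have hmc : m ≤ c := C.min'_le c hc
    grind
  · obtain ⟨c, hc, h⟩ := C.exists_mem_eq_sup' hC fun c => if c ≤ p then c else m
    exact (congrArg (· ∈ C) h).mpr <| ite_mem.2 ⟨fun _ => hc, fun _ => C.min'_mem hC⟩
  · have hmp : m ≤ p := C.min'_le p hp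
    grind
  · exact Finset.le_sup'_of_le _ hp (if_pos le_rfl).ge

theorem affineSimplex_map_eq_self {n : ℕ} {e : Fin (n + 1) → Fin (n + 1)} {v : AffineSimplex n}
    (he : ∀ p, v.1 p ≠ 0 → e p = p) : AffineSimplex.map e v = v := by
  ext k
  calc ∑ p with e p = k, v.1 p = ∑ p, if p = k then v.1 p else 0 := by
        rw [Finset.sum_filter]
        refine Finset.sum_congr rfl fun p _ => ?_
        by_cases hp : v.1 p = 0
        · simp only [hp, ite_self]
        · rw [he p hp]
    _ = v.1 k := by simp

/-- The affine retraction of `ℝⁿ⁺¹` onto `𝔸ⁿ` in the direction of the `i`-th coordinate. -/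
noncomputable def affineRetraction {n : ℕ} (i : Fin (n + 1))
    (x : EuclideanSpace ℝ (Fin (n + 1))) : AffineSimplex n :=
  ⟨x + EuclideanSpace.single i (1 - ∑ k, x k), by simp [Finset.sum_add_distrib]⟩

theorem affineRetraction_coe {n : ℕ} (i : Fin (n + 1)) (v : AffineSimplex n) :
    affineRetraction i (v : EuclideanSpace ℝ (Fin (n + 1))) = v := by
  ext k
  simp [affineRetraction, v.2]

theorem affineRetraction_apply_of_ne {n : ℕ} {i j : Fin (n + 1)} (hj : j ≠ i)
    (x : EuclideanSpace ℝ (Fin (n + 1))) : (affineRetraction i x).1 j = x j := by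
  simp [affineRetraction, hj]

theorem dSmooth_affineRetraction {n : ℕ} (i : Fin (n + 1)) : DSmooth (affineRetraction i) := by
  refine dSmooth_subtype_mk (ContDiff.dSmooth ?_) _
  refine contDiff_id.add (contDiff_euclidean.2 fun j => ?_)
  have hsum : ContDiff ℝ ∞ fun x : EuclideanSpace ℝ (Fin (n + 1)) => 1 - ∑ k, x k := by fun_prop
  by_cases hj : j = i
  · simpa [hj] using hsum
  · simpa [hj] using contDiff_const

/-- The projection of `ℝ^ι` onto the coordinate hyperplane `x j = 0`. -/
noncomputable def eraseCoord {ι : Type*} [Fintype ι] [DecidableEq ι] (j : ι) :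
    EuclideanSpace ℝ ι →L[ℝ] EuclideanSpace ℝ ι :=
  .id ℝ _ - (EuclideanSpace.proj j).smulRight (EuclideanSpace.single j 1)

section EraseCoord

variable {ι : Type*} [Fintype ι] [DecidableEq ι]

theorem eraseCoord_apply (j k : ι) (x : EuclideanSpace ℝ ι) :
    eraseCoord j x k = if k = j then 0 else x k := by
  by_cases hkj : k = j <;> simp [eraseCoord, hkj]

theorem isIdempotentElem_eraseCoord (j : ι) : IsIdempotentElem (eraseCoord j) := by
  ext x k
  simp only [mul_apply_eq_comp, eraseCoord_apply]
  grind

theorem commute_eraseCoord (j k : ι) : Commute (eraseCoord j) (eraseCoord k) := by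
  ext x l
  simp only [mul_apply_eq_comp, eraseCoord_apply]
  grind

theorem mem_fixedPoints_eraseCoord {j : ι} {x : EuclideanSpace ℝ ι} :
    x ∈ fixedPoints (eraseCoord j) ↔ x j = 0 := by
  refine ⟨fun hx => ?_, fun hx => ?_⟩
  · rw [← mem_fixedPoints_iff.1 hx, eraseCoord_apply, if_pos rfl]
  · ext k
    rw [eraseCoord_apply, ite_eq_right_iff]
    rintro rfl
    exact hx.symm

end EraseCoord

theorem exists_leftInverse_succAbove {n : ℕ} (j : Fin (n + 2)) :
    ∃ s : Fin (n + 2) → Fin (n + 1), LeftInverse s j.succAbove ∧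
      ∀ p ≠ j, j.succAbove (s p) = p := by
  refine ⟨invFun j.succAbove, leftInverse_invFun Fin.succAbove_right_injective, fun p hp => ?_⟩
  exact invFun_eq (Fin.exists_succAbove_eq hp)

variable {Y : Type*} [DiffeologicalSpace Y]

theorem IsHorn.apply_map_eq_apply_map {n : ℕ} {i : Fin (n + 2)}
    {σ : ∀ j, j ≠ i → SmoothMap (AffineSimplex n) Y} (hσ : IsHorn i σ) {j k : Fin (n + 2)}
    (hj : j ≠ i) (hk : k ≠ i) {s t : Fin (n + 2) → Fin (n + 1)}
    (hs : ∀ p ≠ j, j.succAbove (s p) = p) (ht : ∀ p ≠ k, k.succAbove (t p) = p)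
    {v : AffineSimplex (n + 1)} (hvj : v.1 j = 0) (hvk : v.1 k = 0) :
    σ j hj (AffineSimplex.map s v) = σ k hk (AffineSimplex.map t v) := by
  -- `s` and `t` need not be monotone, but become so after retracting onto the vertices `≠ j, k`.
  obtain ⟨e, he_mem, he_id⟩ := exists_orderHom_mem_and_eqOn_id (C := {j, k}ᶜ)
    ⟨i, by simp [hj.symm, hk.symm]⟩
  have he_ne (p) : e p ≠ j ∧ e p ≠ k := by simpa using he_mem p
  have monotone_comp {l : Fin (n + 2)} {r : Fin (n + 2) → Fin (n + 1)}
      (hr : ∀ p ≠ l, l.succAbove (r p) = p) (hl : ∀ p, e p ≠ l) : Monotone (r ∘ e) :=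
    fun p q hpq => by
      rw [← (Fin.strictMono_succAbove l).le_iff_le]
      simpa only [comp_apply, hr _ (hl _)] using e.monotone hpq
  have hev : AffineSimplex.map e v = v := affineSimplex_map_eq_self fun p hp =>
    he_id (by simpa using ⟨fun h => hp (h ▸ hvk), fun h => hp (h ▸ hvj)⟩)
  calc σ j hj (AffineSimplex.map s v)
      = σ j hj (AffineSimplex.map (s ∘ e) v) := by rw [← AffineSimplex.map_map, hev]
    _ = σ k hk (AffineSimplex.map (t ∘ e) v) :=
        hσ j k hj hk (n + 1) ⟨s ∘ e, monotone_comp hs fun p => (he_ne p).1⟩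
          ⟨t ∘ e, monotone_comp ht fun p => (he_ne p).2⟩
          (fun p => (hs _ (he_ne p).1).trans (ht _ (he_ne p).2).symm) v
    _ = σ k hk (AffineSimplex.map t v) := by rw [← AffineSimplex.map_map, hev]

theorem IsHorn.exists_filler {τ : Displacement Y} (hτ : τ.IsExact) {n : ℕ} {i : Fin (n + 2)}
    {σ : ∀ j, j ≠ i → SmoothMap (AffineSimplex n) Y} (hσ : IsHorn i σ) :
    ∃ ρ : SmoothMap (AffineSimplex (n + 1)) Y,
      ∀ j hj v, ρ (AffineSimplex.map j.succAbove v) = σ j hj v := by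
  choose s hs_inv hs using fun j : Fin (n + 2) => exists_leftInverse_succAbove j
  let f (j : {j // j ≠ i}) (u : EuclideanSpace ℝ (Fin (n + 2))) : Y :=
    σ j j.2 (AffineSimplex.map (s j) (affineRetraction i u))
  have hf (j) : DSmooth (f j) :=
    ((σ j j.2).smooth.comp (AffineSimplex.dSmooth_map _)).comp (dSmooth_affineRetraction i)
  have hf_compat (j k) : EqOn (f j) (f k)
      (fixedPoints (eraseCoord j.1) ∩ fixedPoints (eraseCoord k.1)) := by
    rintro u ⟨huj, huk⟩
    rw [mem_fixedPoints_eraseCoord] at huj huk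
    exact hσ.apply_map_eq_apply_map j.2 k.2 (hs j) (hs k)
      ((affineRetraction_apply_of_ne j.2 u).trans huj)
      ((affineRetraction_apply_of_ne k.2 u).trans huk)
  obtain ⟨j₀, hj₀⟩ := exists_ne i
  have : Nonempty Y := ⟨f ⟨j₀, hj₀⟩ 0⟩
  obtain ⟨F, hF, hFf⟩ := hτ.exists_eqOn_fixedPoints (fun j => isIdempotentElem_eraseCoord j.1)
    (fun j k => commute_eraseCoord j.1 k.1) hf hf_compat
  refine ⟨⟨fun v => F v.1, hF.comp dSmooth_subtype_val⟩, fun j hj v => ?_⟩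
  have hvj : (AffineSimplex.map j.succAbove v).1 j = 0 := by
    simp [AffineSimplex.map, Fin.succAbove_ne]
  calc F (AffineSimplex.map j.succAbove v)
      = f ⟨j, hj⟩ (AffineSimplex.map j.succAbove v) :=
        hFf ⟨j, hj⟩ (mem_fixedPoints_eraseCoord.2 hvj)
    _ = σ j hj (AffineSimplex.map (s j ∘ j.succAbove) v) := by
        simp only [f, affineRetraction_coe, AffineSimplex.map_map]
    _ = σ j hj v := by rw [(hs_inv j).comp_eq_id, AffineSimplex.map_id]

theorem Displacement.IsExact.fibrant {τ : Displacement Y} (hτ : τ.IsExact) : Fibrant Y :=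
  fibrant_of_forall_isHorn fun _ _ _ hσ => hσ.exists_filler hτ

end Horns

theorem mainTheorem9_general {N : Type*} [DiffeologicalSpace N] {τ : Displacement N}
    (hτ : τ.IsExact) {X : Type*} [DiffeologicalSpace X] (hX : @CompactSpace X dTopology) :
    Fibrant (SmoothMap X N) ∧ ∀ (x₀ : X) (n₀ : N), Fibrant (PointedSmoothMap X N x₀ n₀) := by
  refine ⟨(hτ.mapping hX).fibrant, fun x₀ n₀ => ?_⟩
  refine ((hτ.mapping hX).restrict (P := fun f => f x₀ = n₀) fun f g h t hf hg hh => ?_).fibrant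
  calc τ.move (f x₀) (g x₀) (h x₀) t = τ.move n₀ n₀ n₀ t := by rw [hf, hg, hh]
    _ = n₀ := τ.move_self n₀ n₀ t

open Diffeology in
theorem mainTheorem9 (d : ℕ) (N : Type*) [TopologicalSpace N]
    [ChartedSpace (EuclideanSpace ℝ (Fin d)) N] [IsManifold (𝓡 d) ∞ N]
    [T2Space N] [SecondCountableTopology N] :
    letI : DiffeologicalSpace N := standardDiffeology d N
    letI : DiffeologicalSpace Circle := standardDiffeology 1 Circle
    (∀ (X : Type*) [DiffeologicalSpace X], @CompactSpace X dTopology →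
      Fibrant (SmoothMap X N) ∧
      ∀ (x₀ : X) (n₀ : N), Fibrant (PointedSmoothMap X N x₀ n₀)) ∧
    Fibrant (SmoothMap Circle N) ∧
    ∀ (s₀ : Circle) (n₀ : N), Fibrant (PointedSmoothMap Circle N s₀ n₀) := by
  let : DiffeologicalSpace N := standardDiffeology d N
  let : DiffeologicalSpace Circle := standardDiffeology 1 Circle
  obtain ⟨τ, hτ⟩ := exists_isExact_displacement d N
  exact ⟨fun X _ hX => mainTheorem9_general hτ hX,
    mainTheorem9_general hτ compactSpace_dTopology_circle⟩
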